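/- Let $a\ge 2$ and $d$ be fixed, and let $$X_{ik}=\mu_i+\epsilon_{ik}\in\mathbb R^d,\qquad i=1,\dots,a,\ k=1,2,\dots,$$ where the vectors $\epsilon_{ik}$ are independent, for fixed $i$ and $j$ the components $\epsilon_{ikj}$, $k\ge1$, are identically distributed with $E(\epsilon_{ikj})=0$ and finite second moment, and $\operatorname{Var}(\epsilon_{ik})=\Sigma_i\ge 0$ for all $k$. Consider a sequence of sample sizes $(n_1,\dots,n_a)$ with $N=\sum_{i}n_i\to\infty$ and $n_i/N\to\kappa_i\in(0,1]$ for each $i$; all limits are along this sequence. Put $\mu=(\mu_1^\top,\dots,\mu_a^\top)^\top$, $\overline X_{i\cdot}=n_i^{-1}\sum_{k=1}^{n_i}X_{ik}$, $\overline X=(\overline X_{1\cdot}^\top,\dots,\overline X_{a\cdot}^\top)^\top$ and $\Sigma=\bigoplus_{i=1}^a\kappa_i^{-1}\Sigma_i$ (block diagonal). Consider the global hypothesis $\mathcal H_0:C\mu=\beta$ with $C=(C_1^\top,\dots,C_L^\top)^\top$, $\beta=(\beta_1^\top,\dots,\beta_L^\top)^\top$, $C_\ell\in\mathbb R^{r_\ell\times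 ad}$, $\beta_\ell\in\mathbb R^{r_\ell}$, and the local hypotheses $\mathcal H_0^{(\ell)}:C_\ell\mu=\beta_\ell$, $\ell=1,\dots,L$. Let $M$ be a function that assigns to a matrix with $ad$ columns and $s$ rows and to an $ad\times ad$ matrix an $s\times s$ matrix, such that $M(C_\ell,S)$ is symmetric and positive semidefinite for every $\ell$ and every positive semidefinite $S$. Let $\widetilde\Sigma=\widetilde\Sigma_N$ be random $ad\times ad$ matrices with $\widetilde\Sigma\to\Sigma$ and $M(C_\ell,\widetilde\Sigma)\to M(C_\ell,\Sigma)$ in probability for every $\ell$ (all these matrices being measurable). Define $$Q_{N\ell}=N\cdot\frac{[C_\ell\overline X-\beta_\ell]^\top M(C_\ell,\widetilde\Sigma)[C_\ell\overline X-\beta_\ell]}{\sqrt{2\operatorname{tr}([C_\ell^\top M(C_\ell,\widetilde\Sigma)C_\ell\widetilde\Sigma]^2)}}\cdot\mathbf 1\Big(\operatorname{tr}\big([C_\ell^\top M(C_\ell,\widetilde\Sigma)C_\ell\widetilde\Sigma]^2\big)>0\Big)$$ (which is $0$ when the indicator is $0$) and $v_{\ell\ell}=2\operatorname{tr}([C_\ell^\top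 M(C_\ell,\Sigma)C_\ell\Sigma]^2)$. Let $Z\sim\mathcal N_{ad}(0,\Sigma)$ be one Gaussian vector and $$Q_\ell=v_{\ell\ell}^{-1/2}\,[C_\ell Z]^\top M(C_\ell,\Sigma)\,C_\ell Z,\qquad \ell=1,\dots,L.$$ Then the following hold. 1. For every $\ell$ with $v_{\ell\ell}>0$ for which $\mathcal H_0^{(\ell)}$ is true, $Q_{N\ell}\to Q_\ell$ in distribution, and $$Q_\ell\stackrel{\mathcal D}{=}\frac1{\sqrt{v_{\ell\ell}}}\sum_{i=1}^{r_\ell}\lambda_i\Upsilon_i,$$ where $\Upsilon_1,\dots,\Upsilon_{r_\ell}$ are i.i.d. $\chi^2_1$ and $\lambda_1,\dots,\lambda_{r_\ell}$ are the nonzero eigenvalues, counted with multiplicity, of the $ad\times ad$ matrix $\Sigma^{1/2}C_\ell^\top M(C_\ell,\Sigma)C_\ell\Sigma^{1/2}$ (there are at most $r_\ell$ of them), filled up with zeros to length $r_\ell$. 2. If $v_{\ell\ell}>0$ for all $\ell$ and $\mathcal H_0$ is true, then $(Q_{N1},\dots,Q_{NL})^\top\to(Q_1,\dots,Q_L)^\top$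 in distribution. 3. If $\mathcal T\subset\{1,\dots,L\}$ is a set of indices of true local hypotheses (in particular the set of all of them) and $v_{\ell\ell}>0$ for all $\ell\in\mathcal T$, then $(Q_{N\ell})_{\ell\in\mathcal T}\to(Q_\ell)_{\ell\in\mathcal T}$ in distribution. -/

import Mathlib

open MeasureTheory ProbabilityTheory Filter Topology
open scoped MatrixOrder Matrix

namespace QFMCT

/-- The observations `X_{ik} = μ_i + ε_{ik}` of group `i` and subject `k` (subjects are numbered
from `0`). -/
def obs {Ω : Type*} {a d : ℕ} (μ : Fin a × Fin d → ℝ) (ε : Fin a → ℕ → Ω → Fin d → ℝ)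
    (i : Fin a) (k : ℕ) (ω : Ω) (j : Fin d) : ℝ :=
  μ (i, j) + ε i k ω j

/-- The vector of group-wise means `(X̄_{1·}ᵀ, …, X̄_{a·}ᵀ)ᵀ`, where group `i` contributes the
subjects `0, …, n i - 1`. -/
noncomputable def groupMeans {Ω : Type*} {a d : ℕ} (X : Fin a → ℕ → Ω → Fin d → ℝ)
    (n : Fin a → ℕ) (ω : Ω) : Fin a × Fin d → ℝ :=
  fun p => (n p.1 : ℝ)⁻¹ * ∑ k ∈ Finset.range (n p.1), X p.1 k ω p.2

/-- The block-diagonal matrix `⨁ᵢ κᵢ⁻¹ Σᵢ`. -/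
noncomputable def pooledCov {a d : ℕ} (κ : Fin a → ℝ) (S : Fin a → Matrix (Fin d) (Fin d) ℝ) :
    Matrix (Fin a × Fin d) (Fin a × Fin d) ℝ :=
  (Matrix.blockDiagonal fun i => (κ i)⁻¹ • S i).submatrix Prod.swap Prod.swap

/-- The `ℓ`-th row block `C_ℓ` of a hypothesis matrix `C = (C_1ᵀ, …, C_Lᵀ)ᵀ`, whose rows are
indexed by pairs of a block number and a row number inside that block. -/
def blockMat {L : ℕ} {r : Fin L → ℕ} {ι : Type*} (C : Matrix ((ℓ : Fin L) × Fin (r ℓ)) ι ℝ)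
    (ℓ : Fin L) : Matrix (Fin (r ℓ)) ι ℝ :=
  C.submatrix (fun t => ⟨ℓ, t⟩) id

/-- The `ℓ`-th block `β_ℓ` of `β = (β_1ᵀ, …, β_Lᵀ)ᵀ`. -/
def blockVec {L : ℕ} {r : Fin L → ℕ} (β : ((ℓ : Fin L) × Fin (r ℓ)) → ℝ)
    (ℓ : Fin L) : Fin (r ℓ) → ℝ :=
  fun t => β ⟨ℓ, t⟩

/-- `2 tr([Cᵀ M C S]²)`, the squared standardization of the quadratic form given by `M`. -/
def stdSq {r : ℕ} {ι : Type*} [Fintype ι] [DecidableEq ι] (C : Matrix (Fin r) ι ℝ)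
    (M : Matrix (Fin r) (Fin r) ℝ) (S : Matrix ι ι ℝ) : ℝ :=
  2 * ((Cᵀ * M * C * S) ^ 2).trace

/-- The standardized quadratic form
`N · [C x - β]ᵀ M [C x - β] / √(2 tr([Cᵀ M C S]²)) · 1(tr([Cᵀ M C S]²) > 0)`; it is `0` when the
indicator vanishes. -/
noncomputable def quadStat {r : ℕ} {ι : Type*} [Fintype ι] [DecidableEq ι] (N : ℝ)
    (C : Matrix (Fin r) ι ℝ) (β : Fin r → ℝ) (M : Matrix (Fin r) (Fin r) ℝ) (S : Matrix ι ι ℝ)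
    (x : ι → ℝ) : ℝ :=
  open Classical in
  if 0 < ((Cᵀ * M * C * S) ^ 2).trace then
    N * ((C *ᵥ x - β) ⬝ᵥ (M *ᵥ (C *ᵥ x - β))) / √(stdSq C M S)
  else 0

/-- The limiting quadratic form `v^{-1/2} · [C z]ᵀ M [C z]` with `v = 2 tr([Cᵀ M C S]²)`. -/
noncomputable def limitForm {r : ℕ} {ι : Type*} [Fintype ι] [DecidableEq ι]
    (C : Matrix (Fin r) ι ℝ) (M : Matrix (Fin r) (Fin r) ℝ) (S : Matrix ι ι ℝ)
    (z : ι → ℝ) : ℝ :=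
  (√(stdSq C M S))⁻¹ * ((C *ᵥ z) ⬝ᵥ (M *ᵥ (C *ᵥ z)))

/-- The matrix `S^{1/2} Cᵀ M C S^{1/2}`, with the positive semidefinite square root of `S`. -/
noncomputable def weightMatrix {r : ℕ} {ι : Type*} [Fintype ι] [DecidableEq ι]
    (C : Matrix (Fin r) ι ℝ) (M : Matrix (Fin r) (Fin r) ℝ) (S : Matrix ι ι ℝ) : Matrix ι ι ℝ :=
  CFC.sqrt S * Cᵀ * M * C * CFC.sqrt S

/-- The `χ²₁` distribution, the law of the square of a standard normal variable. -/
noncomputable def chiSqOne : Measure ℝ := (gaussianReal 0 1).map fun x => x ^ 2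

instance : IsProbabilityMeasure chiSqOne :=
  Measure.isProbabilityMeasure_map (by fun_prop)

/-- The reals `w 0, …, w (r-1)` are the nonzero eigenvalues of the symmetric matrix `A`, counted
with multiplicity and filled up with zeros. -/
def AreNonzeroEigenvaluesPadded {r : ℕ} {ι : Type*} [Fintype ι] [DecidableEq ι]
    (w : Fin r → ℝ) (A : Matrix ι ι ℝ) : Prop :=
  open Classical in
  (Finset.univ.val.map w).filter (fun x => x ≠ 0) = A.charpoly.roots.filter (fun x => x ≠ 0)

end QFMCT

/-!
The components of the errors are identically distributed within a group, but the error vectors need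
not be, so the multivariate central limit theorem for i.i.d. vectors does not apply. The scaled means
`√N (X̄ - μ)` are treated by Lindeberg's method instead. By independence their characteristic
function is a product over groups and subjects (`charFun_scaledMeans`). Each factor is replaced by
the Gaussian one, at the cost of an error governed by a truncated second moment of a linear
combination of the components (`norm_charFun_sub_le`). Such a combination is large only if some
component is, so the truncated moments have a common bound that depends only on the marginal laws
(`dampedSecondMoment_sum_le`, `dampedSecondMoment_congr`); hence the product converges
(`tendsto_prod_charFun`), and Lévy's theorem gives `tendstoInDistribution_scaledMeans`.

Under a true local hypothesis, `Q_{Nℓ}` is a quadratic form in `√N (X̄ - μ)`, whose matrix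
`standardizedForm` is a function of the two estimated matrices that is continuous wherever the trace
is positive. It therefore converges in probability, and Slutsky's theorem, applied to all forms at
once (`tendstoInDistribution_quadForms`), gives the joint convergence.

For the law of the limit, `Z` is written as `Σ^{1/2} G` with `G` standard Gaussian. In an orthonormal
eigenbasis of the weight matrix the form becomes a sum of independent `χ²₁` variables weighted by
the eigenvalues (`map_quadForm_stdGaussian`). Characteristic functions show that only the multiset
of nonzero weights matters (`map_sum_mul_pi_eq`), and the rank bounds their number by `r ℓ`.
-/

namespace QFMCT

/-! ### Characteristic functions and Lindeberg's condition -/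

lemma norm_exp_mul_I_sub_taylor_le (x : ℝ) :
    ‖Complex.exp (x * Complex.I) - (1 + x * Complex.I - x ^ 2 / 2)‖
      ≤ 4 * (x ^ 2 * min 1 |x|) := by
  have hx : ‖(x : ℂ) * Complex.I‖ = |x| := by simp
  rcases le_total |x| 1 with h | h
  · have := Complex.exp_bound (x := x * Complex.I) (by rw [hx]; exact h) (n := 3) (by norm_num)
    rw [hx] at this
    simp only [Finset.sum_range_succ, Finset.sum_range_zero] at this
    rw [min_eq_right h]
    have e : (0 + ((x : ℂ) * Complex.I) ^ 0 / (Nat.factorial 0 : ℕ)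
        + ((x : ℂ) * Complex.I) ^ 1 / (Nat.factorial 1 : ℕ)
        + ((x : ℂ) * Complex.I) ^ 2 / (Nat.factorial 2 : ℕ))
        = 1 + x * Complex.I - x ^ 2 / 2 := by
      simp [mul_pow]; ring
    rw [e] at this
    refine this.trans ?_
    have h3 : |x| ^ 3 = x ^ 2 * |x| := by rw [pow_succ, sq_abs]
    rw [h3]
    have : 0 ≤ x ^ 2 * |x| := by positivity
    norm_num [Nat.factorial]
    nlinarith
  · rw [min_eq_left h]
    have h1 : ‖Complex.exp (x * Complex.I)‖ = 1 := Complex.norm_exp_ofReal_mul_I x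
    have h2 : ‖(1 + x * Complex.I - x ^ 2 / 2 : ℂ)‖ ≤ 1 + |x| + x ^ 2 / 2 := by
      refine (norm_sub_le _ _).trans (add_le_add ((norm_add_le _ _).trans ?_) ?_)
      · rw [hx]; simp
      · simp
    have h3 := norm_sub_le (Complex.exp (x * Complex.I)) (1 + x * Complex.I - x ^ 2 / 2)
    rw [h1] at h3
    have : |x| ^ 2 = x ^ 2 := sq_abs x
    nlinarith

/-- The second moment of `Y` with the part where `|s Y|` is small damped by the factor `|s Y|`.
It bounds the error of the second-order expansion of the characteristic function at `s`, and it
plays the role of the truncated second moment in Lindeberg's condition. -/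
noncomputable def dampedSecondMoment {Ω : Type*} [MeasurableSpace Ω] (P : Measure Ω) (Y : Ω → ℝ)
    (s : ℝ) : ℝ :=
  ∫ ω, Y ω ^ 2 * min 1 |s * Y ω| ∂P

section
variable {Ω : Type*} [MeasurableSpace Ω] {P : Measure Ω}

lemma integrable_sq_mul_min {Y : Ω → ℝ} (hY : MemLp Y 2 P) (s : ℝ) :
    Integrable (fun ω => Y ω ^ 2 * min 1 |s * Y ω|) P := by
  have hm := hY.aestronglyMeasurable.aemeasurable
  refine hY.integrable_sq.mono' (AEMeasurable.aestronglyMeasurable ?_) (ae_of_all _ fun ω => ?_)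
  · exact (hm.pow_const 2).mul (aemeasurable_const.min ((hm.const_mul s).norm))
  · rw [Real.norm_of_nonneg (by positivity)]
    exact mul_le_of_le_one_right (sq_nonneg _) (min_le_left _ _)

lemma tendsto_dampedSecondMoment {Y : Ω → ℝ} (hY : MemLp Y 2 P) :
    Tendsto (dampedSecondMoment P Y) (𝓝 0) (𝓝 0) := by
  have h0 : (0 : ℝ) = ∫ _, (0 : ℝ) ∂P := by simp
  rw [h0]
  refine tendsto_integral_filter_of_dominated_convergence (fun ω => Y ω ^ 2)
    (Eventually.of_forall fun s => (integrable_sq_mul_min hY s).aestronglyMeasurable)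
    (Eventually.of_forall fun s => ae_of_all _ fun ω => ?_) hY.integrable_sq
    (ae_of_all _ fun ω => ?_)
  · rw [Real.norm_of_nonneg (by positivity)]
    exact mul_le_of_le_one_right (sq_nonneg _) (min_le_left _ _)
  · have : Continuous fun s : ℝ => Y ω ^ 2 * min 1 |s * Y ω| := by fun_prop
    simpa using this.tendsto 0

/-- The second-order expansion of a characteristic function, with a remainder that needs no moments
beyond the second. -/
lemma norm_charFun_sub_le [IsProbabilityMeasure P] {Y : Ω → ℝ} (hY : MemLp Y 2 P)
    (h0 : ∫ ω, Y ω ∂P = 0) (s : ℝ) :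
    ‖charFun (P.map Y) s - ((1 - (∫ ω, Y ω ^ 2 ∂P) * s ^ 2 / 2 : ℝ) : ℂ)‖
      ≤ 4 * s ^ 2 * dampedSecondMoment P Y s := by
  have hm := hY.aestronglyMeasurable.aemeasurable
  have hi : Integrable Y P := hY.integrable (by norm_num)
  have hi2 := hY.integrable_sq
  have e1 : charFun (P.map Y) s = ∫ ω, Complex.exp (((s * Y ω : ℝ) : ℂ) * Complex.I) ∂P := by
    rw [charFun_apply_real, integral_map hm (by fun_prop)]
    simp
  have hA : Integrable (fun ω => ((s * Y ω : ℝ) : ℂ) * Complex.I) P :=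
    ((hi.const_mul s).ofReal).mul_const _
  have hA1 : Integrable (fun ω => 1 + ((s * Y ω : ℝ) : ℂ) * Complex.I) P :=
    (integrable_const _).add hA
  have hB : Integrable (fun ω => ((s * Y ω : ℝ) : ℂ) ^ 2 / 2) P := by
    have : Integrable (fun ω => ((s ^ 2 / 2 * Y ω ^ 2 : ℝ) : ℂ)) P :=
      (hi2.const_mul (s ^ 2 / 2)).ofReal
    refine this.congr (ae_of_all _ fun ω => ?_)
    push_cast; ring
  have e2 : ((1 - (∫ ω, Y ω ^ 2 ∂P) * s ^ 2 / 2 : ℝ) : ℂ)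
      = ∫ ω, (1 + ((s * Y ω : ℝ) : ℂ) * Complex.I - ((s * Y ω : ℝ) : ℂ) ^ 2 / 2) ∂P := by
    rw [integral_sub hA1 hB, integral_add (integrable_const _) hA,
      integral_mul_const, integral_complex_ofReal, integral_const_mul, h0]
    have : (∫ ω, ((s * Y ω : ℝ) : ℂ) ^ 2 / 2 ∂P)
        = (((∫ ω, Y ω ^ 2 ∂P) * s ^ 2 / 2 : ℝ) : ℂ) := by
      rw [← integral_mul_const, ← integral_div, ← integral_complex_ofReal]
      congr 1; ext ω; push_cast; ring
    rw [this]; simp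
  have hint : Integrable (fun ω => Complex.exp (((s * Y ω : ℝ) : ℂ) * Complex.I)) P := by
    refine (integrable_const (1 : ℝ)).mono' (by fun_prop) (ae_of_all _ fun ω => ?_)
    rw [Complex.norm_exp_ofReal_mul_I]
  have hint2 : Integrable
      (fun ω => 1 + ((s * Y ω : ℝ) : ℂ) * Complex.I - ((s * Y ω : ℝ) : ℂ) ^ 2 / 2) P := hA1.sub hB
  rw [e1, e2, ← integral_sub hint hint2, dampedSecondMoment, ← integral_const_mul]
  refine norm_integral_le_of_norm_le ((integrable_sq_mul_min hY s).const_mul _)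
    (ae_of_all _ fun ω => ?_)
  refine (norm_exp_mul_I_sub_taylor_le (s * Y ω)).trans (le_of_eq ?_)
  ring

end

lemma norm_prod_sub_prod_le {ι : Type*} (S : Finset ι) (f g : ι → ℂ)
    (hf : ∀ i ∈ S, ‖f i‖ ≤ 1) (hg : ∀ i ∈ S, ‖g i‖ ≤ 1) :
    ‖∏ i ∈ S, f i - ∏ i ∈ S, g i‖ ≤ ∑ i ∈ S, ‖f i - g i‖ := by
  classical
  induction S using Finset.induction_on with
  | empty => simp
  | insert i S hi ih =>
    rw [Finset.prod_insert hi, Finset.prod_insert hi, Finset.sum_insert hi]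
    have e : f i * ∏ j ∈ S, f j - g i * ∏ j ∈ S, g j
        = (f i - g i) * ∏ j ∈ S, f j + g i * (∏ j ∈ S, f j - ∏ j ∈ S, g j) := by ring
    rw [e]
    have h1 : ‖∏ j ∈ S, f j‖ ≤ 1 := by
      rw [norm_prod]
      exact Finset.prod_le_one (fun _ _ => norm_nonneg _)
        fun j hj => hf j (Finset.mem_insert_of_mem hj)
    have h2 := ih (fun j hj => hf j (Finset.mem_insert_of_mem hj))
      (fun j hj => hg j (Finset.mem_insert_of_mem hj))
    have h3 := hg i (Finset.mem_insert_self _ _)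
    refine (norm_add_le _ _).trans (add_le_add ?_ ?_)
    · rw [norm_mul]; exact mul_le_of_le_one_right (norm_nonneg _) h1
    · rw [norm_mul]
      exact (mul_le_of_le_one_left (norm_nonneg _) h3).trans h2

/-- The characteristic function of a row sum in Lindeberg's theorem: centred variables with common
second moment `v` whose damped second moments have a common bound `h` tending to `0`. -/
lemma tendsto_prod_charFun {Ω : Type*} [MeasurableSpace Ω] {P : Measure Ω}
    [IsProbabilityMeasure P] {Y : ℕ → Ω → ℝ} (hY : ∀ k, MemLp (Y k) 2 P)
    (h0 : ∀ k, ∫ ω, Y k ω ∂P = 0) {v : ℝ} (hv : ∀ k, ∫ ω, Y k ω ^ 2 ∂P = v)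
    {h : ℝ → ℝ} (hh : Tendsto h (𝓝 0) (𝓝 0)) (hb : ∀ k s, dampedSecondMoment P (Y k) s ≤ h s)
    {n : ℕ → ℕ} {s : ℕ → ℝ} {c : ℝ} (hs : Tendsto s atTop (𝓝 0))
    (hns : Tendsto (fun m => n m * s m ^ 2) atTop (𝓝 c)) :
    Tendsto (fun m => ∏ k ∈ Finset.range (n m), charFun (P.map (Y k)) (s m)) atTop
      (𝓝 (Complex.exp ((-(v * c / 2) : ℝ)))) := by
  have hv0 : 0 ≤ v := (hv 0) ▸ integral_nonneg fun ω => sq_nonneg _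
  have hprob : ∀ k, IsProbabilityMeasure (P.map (Y k)) := fun k =>
    Measure.isProbabilityMeasure_map (hY k).aestronglyMeasurable.aemeasurable
  have hG : Tendsto (fun m => ∏ k ∈ Finset.range (n m),
      Complex.exp ((-(v * s m ^ 2 / 2) : ℝ))) atTop (𝓝 (Complex.exp ((-(v * c / 2) : ℝ)))) := by
    simp only [Finset.prod_const, Finset.card_range, ← Complex.exp_nat_mul]
    refine (Complex.continuous_exp.tendsto _).comp ?_
    have := (Complex.continuous_ofReal.tendsto _).comp ((hns.const_mul (v / 2)).neg)
    convert this using 2 with m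
    · simp only [Function.comp]; push_cast; ring
    · congr 2; ring
  rw [← tendsto_sub_nhds_zero_iff] at hG ⊢
  -- replacing the factors one at a time costs at most the sum of the individual errors,
  -- and these are `o(s ^ 2)` uniformly in `k`
  have hD : Tendsto (fun m => ∏ k ∈ Finset.range (n m), charFun (P.map (Y k)) (s m)
      - ∏ k ∈ Finset.range (n m), Complex.exp ((-(v * s m ^ 2 / 2) : ℝ))) atTop (𝓝 0) := by
    have hs2 : Tendsto (fun m => s m ^ 2) atTop (𝓝 0) := by simpa using hs.pow 2
    have hsm : ∀ᶠ m in atTop, v * s m ^ 2 / 2 < 1 := by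
      have : Tendsto (fun m => v * s m ^ 2 / 2) atTop (𝓝 0) := by
        simpa using (hs2.const_mul v).div_const 2
      exact this.eventually_lt_const one_pos
    refine squeeze_zero_norm' (a := fun m =>
      (n m * s m ^ 2) * (4 * h (s m) + v ^ 2 * s m ^ 2 / 4)) ?_ ?_
    · filter_upwards [hsm] with m hm
      refine (norm_prod_sub_prod_le _ _ _ (fun k _ => norm_charFun_le_one _)
        (fun k _ => ?_)).trans ?_
      · rw [Complex.norm_exp_ofReal, Real.exp_le_one_iff]
        have : 0 ≤ v * s m ^ 2 := by positivity
        linarith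
      · have hterm : ∀ k ∈ Finset.range (n m), ‖charFun (P.map (Y k)) (s m)
            - Complex.exp ((-(v * s m ^ 2 / 2) : ℝ))‖
            ≤ s m ^ 2 * (4 * h (s m) + v ^ 2 * s m ^ 2 / 4) := by
          intro k _
          have h1 := norm_charFun_sub_le (hY k) (h0 k) (s m)
          rw [hv k] at h1
          have hq : 0 ≤ v * s m ^ 2 / 2 := by positivity
          have h2 := Real.abs_exp_sub_one_sub_id_le (x := -(v * s m ^ 2 / 2))
            (by rw [abs_neg, abs_of_nonneg hq]; exact hm.le)
          have h3 : ‖((1 - v * s m ^ 2 / 2 : ℝ) : ℂ) - Complex.exp ((-(v * s m ^ 2 / 2) : ℝ))‖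
              ≤ (v * s m ^ 2 / 2) ^ 2 := by
            rw [← Complex.ofReal_exp, ← Complex.ofReal_sub, Complex.norm_real, Real.norm_eq_abs,
              abs_sub_comm]
            convert h2 using 1
            · congr 1; ring
            · ring
          have h4 := mul_le_mul_of_nonneg_left (hb k (s m)) (by positivity : 0 ≤ 4 * s m ^ 2)
          have h5 := norm_sub_le_norm_sub_add_norm_sub (charFun (P.map (Y k)) (s m))
            ((1 - v * s m ^ 2 / 2 : ℝ) : ℂ) (Complex.exp ((-(v * s m ^ 2 / 2) : ℝ)))
          nlinarith
        refine (Finset.sum_le_sum hterm).trans (le_of_eq ?_)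
        simp only [Finset.sum_const, Finset.card_range, nsmul_eq_mul]
        ring
    · have := hns.mul (((hh.comp hs).const_mul 4).add ((hs2.const_mul (v ^ 2)).div_const 4))
      simpa using this
  simpa using hD.add hG

/-! ### Central limit theorem for the group means -/

lemma sq_mul_min_mono (s : ℝ) {x y : ℝ} (h : |x| ≤ |y|) :
    x ^ 2 * min 1 |s * x| ≤ y ^ 2 * min 1 |s * y| := by
  have h1 : x ^ 2 ≤ y ^ 2 := sq_le_sq.2 h
  have h2 : |s * x| ≤ |s * y| := by
    rw [abs_mul, abs_mul]; gcongr
  gcongr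

/-- If the sum is large, then so is some summand, multiplied by the number of summands. -/
lemma sum_sq_mul_min_le {d : ℕ} (s : ℝ) (x : Fin d → ℝ) :
    (∑ j, x j) ^ 2 * min 1 |s * ∑ j, x j| ≤ ∑ j, (d * x j) ^ 2 * min 1 |s * (d * x j)| := by
  rcases isEmpty_or_nonempty (Fin d) with hd | hd
  · simp
  obtain ⟨j₀, hj₀⟩ := Finite.exists_max fun j => |x j|
  have h : |∑ j, x j| ≤ |d * x j₀| := by
    refine (Finset.abs_sum_le_sum_abs _ _).trans ((Finset.sum_le_sum fun j _ => hj₀ j).trans ?_)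
    simp [abs_mul]
  refine (sq_mul_min_mono s h).trans
    (Finset.single_le_sum (f := fun j => (d * x j) ^ 2 * min 1 |s * (d * x j)|)
      (fun j _ => by positivity) (Finset.mem_univ j₀))

section
variable {Ω : Type*} [MeasurableSpace Ω] {P : Measure Ω}

lemma dampedSecondMoment_sum_le {d : ℕ} {X : Fin d → Ω → ℝ} (hX : ∀ j, MemLp (X j) 2 P) (s : ℝ) :
    dampedSecondMoment P (fun ω => ∑ j, X j ω) s
      ≤ ∑ j, dampedSecondMoment P (fun ω => d * X j ω) s := by
  simp only [dampedSecondMoment]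
  have hi : ∀ j, MemLp (fun ω => d * X j ω) 2 P := fun j => (hX j).const_mul _
  rw [← integral_finsetSum _ fun j _ => integrable_sq_mul_min (hi j) s]
  refine integral_mono (integrable_sq_mul_min (memLp_finsetSum _ fun j _ => hX j) s)
    (integrable_finsetSum _ fun j _ => integrable_sq_mul_min (hi j) s) fun ω => ?_
  exact sum_sq_mul_min_le s fun j => X j ω

lemma dampedSecondMoment_congr {X Y : Ω → ℝ} (h : IdentDistrib X Y P P) (s : ℝ) :
    dampedSecondMoment P X s = dampedSecondMoment P Y s :=
  (h.comp (u := fun x : ℝ => x ^ 2 * min 1 |s * x|) (by fun_prop)).integral_eq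

lemma integral_sq_sum_eq_dotProduct [IsProbabilityMeasure P] {d : ℕ} {X : Fin d → Ω → ℝ}
    (hX : ∀ j, MemLp (X j) 2 P) (h0 : ∀ j, ∫ ω, X j ω ∂P = 0) {S : Matrix (Fin d) (Fin d) ℝ}
    (hS : ∀ j j', cov[X j, X j'; P] = S j j') (t : Fin d → ℝ) :
    ∫ ω, (∑ j, t j * X j ω) ^ 2 ∂P = t ⬝ᵥ S *ᵥ t := by
  have hm : ∀ j j', ∫ ω, X j ω * X j' ω ∂P = S j j' := by
    intro j j'
    rw [← hS, covariance_eq_sub (hX j) (hX j'), h0 j]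
    simp
  have hi : ∀ j j', Integrable (fun ω => X j ω * X j' ω) P :=
    fun j j' => (hX j).integrable_mul (hX j')
  have e : ∀ ω, (∑ j, t j * X j ω) ^ 2 = ∑ j, ∑ j', (t j * t j') * (X j ω * X j' ω) := by
    intro ω
    rw [sq, Finset.sum_mul_sum]
    exact Finset.sum_congr rfl fun j _ => Finset.sum_congr rfl fun j' _ => by ring
  simp only [e]
  rw [integral_finsetSum _ fun j _ => integrable_finsetSum _ fun j' _ => (hi j j').const_mul _]
  simp only [dotProduct, Matrix.mulVec, Finset.mul_sum]
  refine Finset.sum_congr rfl fun j _ => ?_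
  rw [integral_finsetSum _ fun j' _ => (hi j j').const_mul _]
  refine Finset.sum_congr rfl fun j' _ => ?_
  rw [integral_const_mul, hm]; ring

lemma posSemidef_of_covariance [IsProbabilityMeasure P] {d : ℕ} {X : Fin d → Ω → ℝ}
    (hX : ∀ j, MemLp (X j) 2 P) (h0 : ∀ j, ∫ ω, X j ω ∂P = 0) {S : Matrix (Fin d) (Fin d) ℝ}
    (hS : ∀ j j', cov[X j, X j'; P] = S j j') : S.PosSemidef := by
  refine Matrix.PosSemidef.of_dotProduct_mulVec_nonneg ?_ fun t => ?_
  · ext j j'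
    simp only [Matrix.conjTranspose_apply, star_trivial]
    rw [← hS, ← hS, covariance_comm]
  · rw [star_trivial, ← integral_sq_sum_eq_dotProduct hX h0 hS t]
    exact integral_nonneg fun ω => sq_nonneg _

end

lemma dotProduct_pooledCov_mulVec {a d : ℕ} (κ : Fin a → ℝ)
    (S : Fin a → Matrix (Fin d) (Fin d) ℝ) (t : Fin a × Fin d → ℝ) :
    t ⬝ᵥ pooledCov κ S *ᵥ t
      = ∑ i, (κ i)⁻¹ * ((fun j => t (i, j)) ⬝ᵥ S i *ᵥ fun j => t (i, j)) := by
  simp only [dotProduct, Matrix.mulVec, Fintype.sum_prod_type, pooledCov, Matrix.submatrix_apply,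
    Prod.swap_prod_mk, Matrix.blockDiagonal_apply, Finset.mul_sum]
  refine Finset.sum_congr rfl fun i _ => Finset.sum_congr rfl fun j _ => ?_
  rw [Finset.sum_eq_single i]
  · refine Finset.sum_congr rfl fun j' _ => ?_
    simp; ring
  · intro i' _ hi'
    simp [Ne.symm hi']
  · simp

lemma posSemidef_pooledCov {a d : ℕ} {κ : Fin a → ℝ} (hκ : ∀ i, 0 ≤ κ i)
    {S : Fin a → Matrix (Fin d) (Fin d) ℝ} (hS : ∀ i, (S i).PosSemidef) :
    (pooledCov κ S).PosSemidef := by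
  refine Matrix.PosSemidef.of_dotProduct_mulVec_nonneg ?_ fun t => ?_
  · ext ⟨i, j⟩ ⟨i', j'⟩
    simp only [Matrix.conjTranspose_apply, star_trivial, pooledCov, Matrix.submatrix_apply,
      Prod.swap_prod_mk, Matrix.blockDiagonal_apply]
    by_cases h : i = i'
    · subst h
      have := (hS i).isHermitian.apply j j'
      simp only [star_trivial] at this
      simp [this]
    · simp [h, Ne.symm h]
  · rw [star_trivial, dotProduct_pooledCov_mulVec]
    refine Finset.sum_nonneg fun i _ => mul_nonneg (inv_nonneg.2 (hκ i)) ?_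
    simpa using (hS i).dotProduct_mulVec_nonneg fun j => t (i, j)

/-- The centred and scaled vector of group means `√N (X̄ - μ)`. -/
noncomputable def scaledMeans {Ω : Type*} {a d : ℕ} (μ : Fin a × Fin d → ℝ)
    (ε : Fin a → ℕ → Ω → Fin d → ℝ) (n : Fin a → ℕ) (ω : Ω) : EuclideanSpace ℝ (Fin a × Fin d) :=
  WithLp.toLp 2 fun p => √((∑ i, n i : ℕ) : ℝ) * (groupMeans (obs μ ε) n ω p - μ p)

lemma groupMeans_obs_sub {Ω : Type*} {a d : ℕ} (μ : Fin a × Fin d → ℝ)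
    (ε : Fin a → ℕ → Ω → Fin d → ℝ) (n : Fin a → ℕ) (ω : Ω) (p : Fin a × Fin d)
    (hn : n p.1 ≠ 0) :
    groupMeans (obs μ ε) n ω p - μ p
      = (n p.1 : ℝ)⁻¹ * ∑ k ∈ Finset.range (n p.1), ε p.1 k ω p.2 := by
  have : (n p.1 : ℝ) ≠ 0 := by exact_mod_cast hn
  simp only [groupMeans, obs, Finset.sum_add_distrib, Finset.sum_const, Finset.card_range,
    nsmul_eq_mul]
  field_simp
  ring

section
variable {Ω : Type*} [MeasurableSpace Ω] {P : Measure Ω} {a d : ℕ}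
  {μ : Fin a × Fin d → ℝ} {ε : Fin a → ℕ → Ω → Fin d → ℝ}

lemma aemeasurable_groupMeans (hε : ∀ i k j, AEMeasurable (fun ω => ε i k ω j) P) (n : Fin a → ℕ)
    (p : Fin a × Fin d) : AEMeasurable (fun ω => groupMeans (obs μ ε) n ω p) P := by
  simp only [groupMeans, obs]
  exact (Finset.aemeasurable_fun_sum _ fun k _ => (hε _ _ _).const_add _).const_mul _

lemma aemeasurable_scaledMeans (hε : ∀ i k j, AEMeasurable (fun ω => ε i k ω j) P)
    (n : Fin a → ℕ) : AEMeasurable (scaledMeans μ ε n) P := by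
  refine (WithLp.measurable_toLp 2 _).comp_aemeasurable (aemeasurable_pi_lambda _ fun p => ?_)
  exact ((aemeasurable_groupMeans hε n p).sub_const _).const_mul _

/-- The inner product with `t` is a double sum of independent variables over groups and subjects, so
its characteristic function factors. -/
lemma charFun_scaledMeans
    (hindep : iIndepFun (fun (p : Fin a × ℕ) (ω : Ω) => ε p.1 p.2 ω) P)
    (hε : ∀ i k j, AEMeasurable (fun ω => ε i k ω j) P) {n : Fin a → ℕ} (hn : ∀ i, n i ≠ 0)
    (t : EuclideanSpace ℝ (Fin a × Fin d)) :
    charFun (P.map (scaledMeans μ ε n)) t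
      = ∏ i, ∏ k ∈ Finset.range (n i), charFun (P.map fun ω => ∑ j, t (i, j) * ε i k ω j)
          (√((∑ i, n i : ℕ) : ℝ) / n i) := by
  have hε' : ∀ i k, AEMeasurable (fun ω => ∑ j, t (i, j) * ε i k ω j) P := fun i k =>
    Finset.aemeasurable_fun_sum _ fun j _ => (hε i k j).const_mul _
  set N : ℝ := ((∑ i, n i : ℕ) : ℝ)
  let Y : (Σ _ : Fin a, ℕ) → Ω → ℝ := fun q ω => √N / n q.1 * ∑ j, t (q.1, j) * ε q.1 q.2 ω j
  have hYm : ∀ q, AEMeasurable (Y q) P := fun q => (hε' q.1 q.2).const_mul _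
  have hY : iIndepFun Y P :=
    (hindep.precomp (g := fun q : (Σ _ : Fin a, ℕ) => (q.1, q.2))
      (fun q q' h => by cases q; cases q'; simp_all)).comp
      (fun q x => √N / n q.1 * ∑ j, t (q.1, j) * x j) (fun q => by fun_prop)
  have e : ∀ ω, inner ℝ (scaledMeans μ ε n ω) t
      = ∑ q ∈ Finset.univ.sigma fun i => Finset.range (n i), Y q ω := by
    intro ω
    rw [Finset.sum_sigma, PiLp.inner_apply, Fintype.sum_prod_type]
    refine Finset.sum_congr rfl fun i _ => ?_
    simp only [scaledMeans, groupMeans_obs_sub μ ε n ω _ (hn _), RCLike.inner_apply,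
      conj_trivial, Y, Finset.mul_sum]
    rw [Finset.sum_comm]
    refine Finset.sum_congr rfl fun k _ => Finset.sum_congr rfl fun j _ => ?_
    ring
  have e1 : charFun (P.map (scaledMeans μ ε n)) t
      = charFun (P.map fun ω => ∑ q ∈ Finset.univ.sigma fun i => Finset.range (n i), Y q ω) 1 := by
    rw [charFun_apply, charFun_apply_real, integral_map (aemeasurable_scaledMeans hε n)
      (by fun_prop), integral_map (Finset.aemeasurable_fun_sum _ fun q _ => hYm q) (by fun_prop)]
    simp [e]
  rw [e1, (hY.restrict _).charFun_map_fun_finsetSum_eq_prod fun q _ => hYm q, Finset.prod_apply,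
    Finset.prod_sigma]
  refine Finset.prod_congr rfl fun i _ => Finset.prod_congr rfl fun k _ => ?_
  rw [charFun_map_mul_comp (hε' i k), mul_one]

/-- Lindeberg's central limit theorem for the scaled group means. -/
theorem tendstoInDistribution_scaledMeans [IsProbabilityMeasure P] {Ω' : Type*} [MeasurableSpace Ω']
    {P' : Measure Ω'} [IsProbabilityMeasure P'] {Sg : Fin a → Matrix (Fin d) (Fin d) ℝ}
    (hindep : iIndepFun (fun (p : Fin a × ℕ) (ω : Ω) => ε p.1 p.2 ω) P)
    (hident : ∀ i j k k', IdentDistrib (fun ω => ε i k ω j) (fun ω => ε i k' ω j) P P)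
    (hL2 : ∀ i k j, MemLp (fun ω => ε i k ω j) 2 P)
    (hmean : ∀ i k j, ∫ ω, ε i k ω j ∂P = 0)
    (hcov : ∀ i k j j', cov[fun ω => ε i k ω j, fun ω => ε i k ω j'; P] = Sg i j j')
    {n : ℕ → Fin a → ℕ} {κ : Fin a → ℝ} (hκ : ∀ i, 0 < κ i)
    (hN : Tendsto (fun m => ∑ i, n m i) atTop atTop)
    (hratio : ∀ i, Tendsto (fun m => (n m i : ℝ) / ((∑ i', n m i' : ℕ) : ℝ)) atTop (𝓝 (κ i)))
    {Z : Ω' → EuclideanSpace ℝ (Fin a × Fin d)}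
    (hZ : HasLaw Z (multivariateGaussian 0 (pooledCov κ Sg)) P') :
    TendstoInDistribution (fun m => scaledMeans μ ε (n m)) atTop Z (fun _ => P) P' := by
  have hε : ∀ i k j, AEMeasurable (fun ω => ε i k ω j) P := fun i k j =>
    (hL2 i k j).aestronglyMeasurable.aemeasurable
  have hS : (pooledCov κ Sg).PosSemidef := posSemidef_pooledCov (fun i => (hκ i).le)
    fun i => posSemidef_of_covariance (hL2 i 0) (hmean i 0) (hcov i 0)
  have hpos : ∀ᶠ m in atTop, ∀ i, n m i ≠ 0 := by
    rw [eventually_all]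
    intro i
    filter_upwards [(hratio i).eventually_ne (hκ i).ne'] with m hm h0
    simp [h0] at hm
  have hNR : Tendsto (fun m => ((∑ i, n m i : ℕ) : ℝ)) atTop atTop :=
    tendsto_natCast_atTop_atTop.comp hN
  refine ⟨fun m => aemeasurable_scaledMeans hε _, hZ.aemeasurable, ?_⟩
  refine ProbabilityMeasure.tendsto_of_tendsto_charFun fun t => ?_
  simp only [ProbabilityMeasure.coe_mk]
  rw [hZ.map_eq, charFun_multivariateGaussian hS]
  have hlim : Complex.exp ((inner ℝ t (0 : EuclideanSpace ℝ (Fin a × Fin d)) : ℝ) * Complex.I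
      - (t.ofLp ⬝ᵥ pooledCov κ Sg *ᵥ t.ofLp : ℝ) / 2)
      = ∏ i, Complex.exp ((-(((fun j => t (i, j)) ⬝ᵥ Sg i *ᵥ fun j => t (i, j)) * (κ i)⁻¹ / 2) : ℝ))
      := by
    rw [← Complex.exp_sum, dotProduct_pooledCov_mulVec, inner_zero_right]
    congr 1
    push_cast
    rw [Finset.sum_div, zero_mul, zero_sub, ← Finset.sum_neg_distrib]
    exact Finset.sum_congr rfl fun i _ => by ring
  rw [hlim]
  refine Tendsto.congr' (hpos.mono fun m hm => (charFun_scaledMeans hindep hε hm t).symm) ?_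
  refine tendsto_finsetProd _ fun i _ => ?_
  have hLp : ∀ k j, MemLp (fun ω => t (i, j) * ε i k ω j) 2 P := fun k j =>
    (hL2 i k j).const_mul _
  -- `n (√N / n)² = N / n → κ⁻¹`
  have hns : Tendsto (fun m => n m i * (√((∑ i, n m i : ℕ) : ℝ) / n m i) ^ 2) atTop
      (𝓝 (κ i)⁻¹) := by
    refine ((hratio i).inv₀ (hκ i).ne').congr' ?_
    filter_upwards [hpos] with m hm
    have : (n m i : ℝ) ≠ 0 := by exact_mod_cast hm i
    rw [div_pow, Real.sq_sqrt (Nat.cast_nonneg _), inv_div]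
    field_simp
  have hs : Tendsto (fun m => √((∑ i, n m i : ℕ) : ℝ) / n m i) atTop (𝓝 0) := by
    have h1 : Tendsto (fun m => (√((∑ i, n m i : ℕ) : ℝ))⁻¹) atTop (𝓝 0) :=
      tendsto_inv_atTop_zero.comp (Real.tendsto_sqrt_atTop.comp hNR)
    have := ((hratio i).inv₀ (hκ i).ne').mul h1
    rw [mul_zero] at this
    refine this.congr' ?_
    filter_upwards [hpos, hNR.eventually_gt_atTop 0] with m hm hm'
    have h2 : (n m i : ℝ) ≠ 0 := by exact_mod_cast hm i
    have h3 : √((∑ i, n m i : ℕ) : ℝ) ≠ 0 := (Real.sqrt_pos.2 hm').ne'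
    have h4 := Real.mul_self_sqrt hm'.le
    rw [inv_div]
    field_simp
    rw [sq, h4]
  -- the laws of the components do not depend on the subject, so subject `0` bounds all of them
  refine tendsto_prod_charFun (Y := fun k ω => ∑ j, t (i, j) * ε i k ω j)
    (h := fun s => ∑ j, dampedSecondMoment P (fun ω => d * (t (i, j) * ε i 0 ω j)) s)
    (fun k => memLp_finsetSum _ fun j _ => hLp k j) (fun k => ?_)
    (fun k => integral_sq_sum_eq_dotProduct (hL2 i k) (hmean i k) (hcov i k) _) ?_
    (fun k s => ?_) hs hns
  · rw [integral_finsetSum _ fun j _ => (hLp k j).integrable (by norm_num)]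
    simp [integral_const_mul, hmean]
  · simpa using tendsto_finsetSum (Finset.univ : Finset (Fin d)) fun j _ =>
      tendsto_dampedSecondMoment ((hLp 0 j).const_mul (d : ℝ))
  · refine (dampedSecondMoment_sum_le (hLp k) s).trans (le_of_eq ?_)
    refine Finset.sum_congr rfl fun j _ => dampedSecondMoment_congr ?_ s
    exact (hident i j k 0).comp (u := fun x => d * (t (i, j) * x)) (by fun_prop)

end

/-! ### Random quadratic forms and Slutsky's theorem -/

section
variable {Ω : Type*} [MeasurableSpace Ω] {P : Measure Ω}

lemma tendstoInMeasure_pi {σ : Type*} [Fintype σ] {E : σ → Type*} [∀ j, PseudoEMetricSpace (E j)]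
    {X : ℕ → Ω → ∀ j, E j} {Y : Ω → ∀ j, E j}
    (h : ∀ j, TendstoInMeasure P (fun m ω => X m ω j) atTop (fun ω => Y ω j)) :
    TendstoInMeasure P X atTop Y := by
  intro δ hδ
  have hsum := tendsto_finsetSum (Finset.univ : Finset σ) fun j _ => h j δ hδ
  simp only [Finset.sum_const_zero] at hsum
  refine tendsto_of_tendsto_of_tendsto_of_le_of_le tendsto_const_nhds hsum (fun _ => zero_le)
    fun m => (measure_mono ?_).trans (measure_biUnion_finset_le _ _)
  intro ω hω
  simp only [Set.mem_ofPred_eq, edist_pi_def, Finset.le_sup_iff (show ⊥ < δ from hδ)] at hω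
  simpa using hω

lemma TendstoInMeasure.comp_continuousAt {E F : Type*} [PseudoEMetricSpace E]
    [PseudoEMetricSpace F] {X : ℕ → Ω → E} {c : E} {f : E → F}
    (h : TendstoInMeasure P X atTop fun _ => c) (hf : ContinuousAt f c) :
    TendstoInMeasure P (fun m ω => f (X m ω)) atTop fun _ => f c := by
  intro δ hδ
  obtain ⟨η, hη, hfη⟩ := EMetric.tendsto_nhds_nhds.1 hf δ hδ
  refine tendsto_of_tendsto_of_tendsto_of_le_of_le tendsto_const_nhds (h η hη) (fun _ => zero_le)
    fun m => measure_mono fun ω hω => ?_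
  by_contra hlt
  exact absurd (hfη (not_le.1 hlt)) (not_lt.2 hω)

end

section
variable {r : ℕ} {ι : Type*} [Fintype ι]

lemma dotProduct_conj_mulVec (C : Matrix (Fin r) ι ℝ) (M : Matrix (Fin r) (Fin r) ℝ)
    (x : ι → ℝ) : x ⬝ᵥ (Cᵀ * M * C) *ᵥ x = (C *ᵥ x) ⬝ᵥ (M *ᵥ (C *ᵥ x)) := by
  rw [← Matrix.mulVec_mulVec, ← Matrix.mulVec_mulVec, Matrix.dotProduct_mulVec,
    Matrix.vecMul_transpose]

variable [DecidableEq ι]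

open Classical in
/-- The matrix of the standardized quadratic form, `Cᵀ M C / √(2 tr([Cᵀ M C S]²))`, and `0` where
the trace is not positive. -/
noncomputable def standardizedForm (C : Matrix (Fin r) ι ℝ) (M : Matrix (Fin r) (Fin r) ℝ)
    (S : Matrix ι ι ℝ) : Matrix ι ι ℝ :=
  (if 0 < ((Cᵀ * M * C * S) ^ 2).trace then (√(stdSq C M S))⁻¹ else 0) • (Cᵀ * M * C)

/-- Under the hypothesis `C μ = β`, the test statistic is a quadratic form in `√N (x - μ)`. -/
lemma quadStat_eq {N : ℝ} (hN : 0 ≤ N) {C : Matrix (Fin r) ι ℝ} {β : Fin r → ℝ} {μ : ι → ℝ}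
    (hβ : C *ᵥ μ = β) (M : Matrix (Fin r) (Fin r) ℝ) (S : Matrix ι ι ℝ) (x : ι → ℝ) :
    quadStat N C β M S x
      = (√N • (x - μ)) ⬝ᵥ standardizedForm C M S *ᵥ (√N • (x - μ)) := by
  have h : C *ᵥ x - β = C *ᵥ (x - μ) := by rw [Matrix.mulVec_sub, hβ]
  unfold quadStat standardizedForm
  rw [h]
  simp only [Matrix.smul_mulVec, Matrix.mulVec_smul, dotProduct_smul, smul_dotProduct,
    dotProduct_conj_mulVec, smul_eq_mul]
  split_ifs
  · rw [div_eq_inv_mul]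
    nth_rw 1 [← Real.mul_self_sqrt hN]
    ring
  · simp

lemma limitForm_eq {C : Matrix (Fin r) ι ℝ} {M : Matrix (Fin r) (Fin r) ℝ} {S : Matrix ι ι ℝ}
    (hv : 0 < stdSq C M S) (z : ι → ℝ) :
    limitForm C M S z = z ⬝ᵥ standardizedForm C M S *ᵥ z := by
  have h : 0 < ((Cᵀ * M * C * S) ^ 2).trace := by simpa [stdSq] using hv
  unfold limitForm standardizedForm
  rw [if_pos h, Matrix.smul_mulVec, dotProduct_smul, dotProduct_conj_mulVec, smul_eq_mul]

lemma continuous_trace_sq (C : Matrix (Fin r) ι ℝ) :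
    Continuous fun A : Matrix (Fin r) (Fin r) ℝ × Matrix ι ι ℝ =>
      ((Cᵀ * A.1 * C * A.2) ^ 2).trace := by
  fun_prop

/-- The indicator in the standardization makes no difference near a point where the trace is
positive. -/
lemma continuousAt_standardizedForm {C : Matrix (Fin r) ι ℝ} {M : Matrix (Fin r) (Fin r) ℝ}
    {S : Matrix ι ι ℝ} (hv : 0 < stdSq C M S) :
    ContinuousAt (fun A : Matrix (Fin r) (Fin r) ℝ × Matrix ι ι ℝ =>
      standardizedForm C A.1 A.2) (M, S) := by
  have hc := continuous_trace_sq C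
  have h : 0 < ((Cᵀ * M * C * S) ^ 2).trace := by simpa [stdSq] using hv
  have hd : Continuous fun A : Matrix (Fin r) (Fin r) ℝ × Matrix ι ι ℝ => stdSq C A.1 A.2 :=
    hc.const_mul 2
  have hcont : ContinuousAt (fun A : Matrix (Fin r) (Fin r) ℝ × Matrix ι ι ℝ =>
      (√(stdSq C A.1 A.2))⁻¹ • (Cᵀ * A.1 * C)) (M, S) := by
    have h1 : ContinuousAt (fun A : Matrix (Fin r) (Fin r) ℝ × Matrix ι ι ℝ =>
        (√(stdSq C A.1 A.2))⁻¹) (M, S) :=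
      ContinuousAt.inv₀ (Real.continuous_sqrt.comp hd).continuousAt (Real.sqrt_pos.2 hv).ne'
    have h2 : Continuous (fun A : Matrix (Fin r) (Fin r) ℝ × Matrix ι ι ℝ => Cᵀ * A.1 * C) := by
      fun_prop
    exact h1.smul h2.continuousAt
  refine hcont.congr ?_
  filter_upwards [hc.continuousAt (x := (M, S)) |>.eventually (lt_mem_nhds h)] with A hA
  rw [standardizedForm, if_pos hA]

variable {Ω : Type*} [MeasurableSpace Ω] {P : Measure Ω}

lemma aemeasurable_standardizedForm {A : Ω → Matrix (Fin r) (Fin r) ℝ} {S : Ω → Matrix ι ι ℝ}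
    (hA : ∀ s t, AEMeasurable (fun ω => A ω s t) P)
    (hS : ∀ p q, AEMeasurable (fun ω => S ω p q) P) (C : Matrix (Fin r) ι ℝ) (p q : ι) :
    AEMeasurable (fun ω => standardizedForm C (A ω) (S ω) p q) P := by
  have hA' : ∀ p q, AEMeasurable (fun ω => (Cᵀ * A ω * C) p q) P := fun p q => by
    simp only [Matrix.mul_apply]
    fun_prop
  have hT : AEMeasurable (fun ω => ((Cᵀ * A ω * C * S ω) ^ 2).trace) P := by
    have h1 : ∀ p q, AEMeasurable (fun ω => (Cᵀ * A ω * C * S ω) p q) P := fun p q => by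
      simp only [Matrix.mul_apply (M := Cᵀ * A _ * C)]
      exact Finset.aemeasurable_fun_sum _ fun k _ => (hA' p k).mul (hS k q)
    simp only [sq, Matrix.trace, Matrix.diag_apply, Matrix.mul_apply (M := Cᵀ * A _ * C * S _)]
    exact Finset.aemeasurable_fun_sum _ fun k _ => Finset.aemeasurable_fun_sum _ fun l _ =>
      (h1 k l).mul (h1 l k)
  simp only [standardizedForm, Matrix.smul_apply, smul_eq_mul, stdSq]
  refine AEMeasurable.mul ?_ (hA' p q)
  exact (Measurable.ite (measurableSet_lt measurable_const measurable_id)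
    (f := fun x : ℝ => (√(2 * x))⁻¹) (g := fun _ => 0) (by fun_prop)
    measurable_const).comp_aemeasurable hT

lemma tendstoInMeasure_standardizedForm {A : ℕ → Ω → Matrix (Fin r) (Fin r) ℝ}
    {S : ℕ → Ω → Matrix ι ι ℝ} {A₀ : Matrix (Fin r) (Fin r) ℝ} {S₀ : Matrix ι ι ℝ}
    (hA : ∀ s t, TendstoInMeasure P (fun m ω => A m ω s t) atTop fun _ => A₀ s t)
    (hS : ∀ p q, TendstoInMeasure P (fun m ω => S m ω p q) atTop fun _ => S₀ p q)
    {C : Matrix (Fin r) ι ℝ} (hv : 0 < stdSq C A₀ S₀) (p q : ι) :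
    TendstoInMeasure P (fun m ω => standardizedForm C (A m ω) (S m ω) p q) atTop
      fun _ => standardizedForm C A₀ S₀ p q := by
  -- the two matrices are combined into one vector of real entries
  let pack : Matrix (Fin r) (Fin r) ℝ → Matrix ι ι ℝ → (Fin r × Fin r) ⊕ (ι × ι) → ℝ :=
    fun A S => Sum.elim (fun x => A x.1 x.2) (fun x => S x.1 x.2)
  let unpack : ((Fin r × Fin r) ⊕ (ι × ι) → ℝ) → Matrix (Fin r) (Fin r) ℝ × Matrix ι ι ℝ :=
    fun x => (Matrix.of fun s t => x (Sum.inl (s, t)), Matrix.of fun p q => x (Sum.inr (p, q)))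
  have hpack : TendstoInMeasure P (fun m ω => pack (A m ω) (S m ω)) atTop
      fun _ => pack A₀ S₀ := by
    refine tendstoInMeasure_pi fun j => ?_
    rcases j with ⟨s, t⟩ | ⟨p, q⟩
    · exact hA s t
    · exact hS p q
  have hun : Continuous unpack := by
    refine Continuous.prodMk ?_ ?_ <;>
    exact continuous_matrix fun _ _ => by simp only [Matrix.of_apply]; fun_prop
  have hup : ∀ A S, unpack (pack A S) = (A, S) := fun A S => rfl
  have hf : ContinuousAt (fun x => standardizedForm C (unpack x).1 (unpack x).2 p q)
      (pack A₀ S₀) := by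
    have h1 : ContinuousAt (fun A : Matrix (Fin r) (Fin r) ℝ × Matrix ι ι ℝ =>
        standardizedForm C A.1 A.2) (unpack (pack A₀ S₀)) := by
      rw [hup]; exact continuousAt_standardizedForm hv
    have h2 := h1.comp hun.continuousAt
    exact ((continuous_id.matrix_elem p q).tendsto _).comp h2
  have := TendstoInMeasure.comp_continuousAt hpack hf
  simpa only [hup] using this

end

/-- Slutsky's theorem for finitely many random quadratic forms in the same vector. -/
theorem tendstoInDistribution_quadForms {Ω Ω' J ι : Type*} [MeasurableSpace Ω]
    [MeasurableSpace Ω'] [Fintype J] [Fintype ι] {P : Measure Ω} [IsProbabilityMeasure P]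
    {P' : Measure Ω'} [IsProbabilityMeasure P'] {Y : ℕ → Ω → EuclideanSpace ℝ ι}
    {Z : Ω' → EuclideanSpace ℝ ι} (hY : TendstoInDistribution Y atTop Z (fun _ => P) P')
    {D : ℕ → Ω → J → ι → ι → ℝ} {D₀ : J → ι → ι → ℝ}
    (hm : ∀ m j p q, AEMeasurable (fun ω => D m ω j p q) P)
    (hD : ∀ j p q, TendstoInMeasure P (fun m ω => D m ω j p q) atTop fun _ => D₀ j p q) :
    TendstoInDistribution
      (fun m ω j => (Y m ω).ofLp ⬝ᵥ Matrix.of (D m ω j) *ᵥ (Y m ω).ofLp) atTop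
      (fun ω' j => (Z ω').ofLp ⬝ᵥ Matrix.of (D₀ j) *ᵥ (Z ω').ofLp) (fun _ => P) P' := by
  have hg : Continuous fun (x : EuclideanSpace ℝ ι × (J → ι → ι → ℝ)) (j : J) =>
      x.1.ofLp ⬝ᵥ Matrix.of (x.2 j) *ᵥ x.1.ofLp := by
    simp only [dotProduct, Matrix.mulVec, Matrix.of_apply]
    fun_prop
  have hE : TendstoInMeasure P D atTop fun _ => D₀ :=
    tendstoInMeasure_pi fun j => tendstoInMeasure_pi fun p => tendstoInMeasure_pi fun q => hD j p q
  have hm' : ∀ m, AEMeasurable (D m) P := fun m =>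
    aemeasurable_pi_lambda _ fun j => aemeasurable_pi_lambda _ fun p =>
      aemeasurable_pi_lambda _ fun q => hm m j p q
  exact hY.continuous_comp_prodMk_of_tendstoInMeasure_const hg hE hm'

/-! ### Gaussian quadratic forms as weighted chi-square sums -/

lemma charFun_map_sum_mul_pi {ι : Type*} [Fintype ι] (ν : Measure ℝ) [IsProbabilityMeasure ν]
    (c : ι → ℝ) (t : ℝ) :
    charFun ((Measure.pi fun _ : ι => ν).map fun y => ∑ i, c i * y i) t
      = ∏ i, charFun ν (c i * t) := by
  have hev : ∀ i : ι, AEMeasurable (fun y : ι → ℝ => y i) (Measure.pi fun _ : ι => ν) :=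
    fun i => (measurable_pi_apply i).aemeasurable
  have hi : iIndepFun (fun (i : ι) (y : ι → ℝ) => c i * y i) (Measure.pi fun _ : ι => ν) :=
    iIndepFun_pi (X := fun i x => c i * x) fun i => by fun_prop
  rw [hi.charFun_map_fun_sum_eq_prod fun i => (hev i).const_mul _, Finset.prod_apply]
  refine Finset.prod_congr rfl fun i _ => ?_
  rw [charFun_map_mul_comp (hev i)]
  exact congrArg (charFun · _) (measurePreserving_eval (fun _ : ι => ν) i).map_eq

open Classical in
lemma prod_map_filter_ne_zero {R : Type*} [CommMonoid R] {F : ℝ → R} (h0 : F 0 = 1)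
    (s : Multiset ℝ) : ((s.filter fun x => x ≠ 0).map F).prod = (s.map F).prod := by
  induction s using Multiset.induction_on with
  | empty => simp
  | cons x s ih =>
    by_cases hx : x = 0
    · rw [Multiset.filter_cons_of_neg _ (by simpa using hx), ih]; simp [hx, h0]
    · rw [Multiset.filter_cons_of_pos (p := fun x => x ≠ 0) _ hx, Multiset.map_cons, Multiset.prod_cons, ih,
        Multiset.map_cons, Multiset.prod_cons]

open Classical in
/-- The law of a linear combination of i.i.d. variables depends only on the multiset of its nonzero
coefficients. -/
lemma map_sum_mul_pi_eq {ι ι' : Type*} [Fintype ι] [Fintype ι'] (ν : Measure ℝ)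
    [IsProbabilityMeasure ν] {c : ι → ℝ} {c' : ι' → ℝ}
    (h : (Finset.univ.val.map c).filter (fun x => x ≠ 0)
      = (Finset.univ.val.map c').filter (fun x => x ≠ 0)) :
    ((Measure.pi fun _ : ι => ν).map fun y => ∑ i, c i * y i)
      = (Measure.pi fun _ : ι' => ν).map fun y => ∑ i, c' i * y i := by
  have hp : IsProbabilityMeasure ((Measure.pi fun _ : ι => ν).map fun y => ∑ i, c i * y i) :=
    Measure.isProbabilityMeasure_map (Measurable.aemeasurable (by fun_prop))
  have hp' : IsProbabilityMeasure ((Measure.pi fun _ : ι' => ν).map fun y => ∑ i, c' i * y i) :=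
    Measure.isProbabilityMeasure_map (Measurable.aemeasurable (by fun_prop))
  refine Measure.ext_of_charFun (funext fun t => ?_)
  have h0 : charFun ν (0 * t) = 1 := by simp
  have key := prod_map_filter_ne_zero (F := fun x => charFun ν (x * t)) h0
  rw [charFun_map_sum_mul_pi, charFun_map_sum_mul_pi]
  calc ∏ i, charFun ν (c i * t)
      = ((Finset.univ.val.map c).map fun x => charFun ν (x * t)).prod := by
        rw [Multiset.map_map]; rfl
    _ = ((Finset.univ.val.map c').map fun x => charFun ν (x * t)).prod := by
        rw [← key, h, key]
    _ = ∏ i, charFun ν (c' i * t) := by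
        rw [Multiset.map_map]; rfl

/-- A symmetric matrix has as many nonzero eigenvalues as its rank, so a bound on the rank leaves
room for all of them. -/
lemma exists_areNonzeroEigenvaluesPadded {r : ℕ} {ι : Type*} [Fintype ι] [DecidableEq ι]
    {A : Matrix ι ι ℝ} (hA : A.IsHermitian) (hr : A.rank ≤ r) :
    ∃ w : Fin r → ℝ, AreNonzeroEigenvaluesPadded w A := by
  classical
  set s : Multiset ℝ := A.charpoly.roots.filter fun x => x ≠ 0 with hs
  have hcard : s.card ≤ r := by
    refine le_trans (le_of_eq ?_) hr
    rw [hs, hA.roots_charpoly_eq_eigenvalues, hA.rank_eq_card_non_zero_eigs, Multiset.filter_map,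
      Multiset.card_map, Fintype.card_subtype]
    simp only [Function.comp_def, RCLike.ofReal_real_eq_id, id_eq]
    rfl
  set l : List ℝ := (s + Multiset.replicate (r - s.card) 0).toList with hl
  have hlen : l.length = r := by
    rw [hl, Multiset.length_toList, Multiset.card_add, Multiset.card_replicate]
    omega
  refine ⟨fun i => l.get (i.cast hlen.symm), ?_⟩
  have hw : (Finset.univ.val.map fun i : Fin r => l.get (i.cast hlen.symm)) = (l : Multiset ℝ) := by
    rw [Fin.univ_val_map]
    congr 1
    exact List.ext_get (by simp [hlen]) fun i h₁ h₂ => by simp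
  unfold AreNonzeroEigenvaluesPadded
  rw [hw, hl, Multiset.coe_toList, Multiset.filter_add]
  have h1 : (Multiset.replicate (r - s.card) (0 : ℝ)).filter (fun x => x ≠ 0) = 0 := by
    rw [Multiset.filter_eq_nil]
    intro x hx
    simp [Multiset.eq_of_mem_replicate hx]
  rw [h1, add_zero, hs, Multiset.filter_filter]
  simp

section
variable {ι : Type*} [Fintype ι] [DecidableEq ι]

lemma dotProduct_mulVec_eigenvectorBasis {A : Matrix ι ι ℝ} (hA : A.IsHermitian) (x : ι → ℝ) :
    (∑ i, x i • hA.eigenvectorBasis i).ofLp ⬝ᵥ A *ᵥ (∑ i, x i • hA.eigenvectorBasis i).ofLp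
      = ∑ i, hA.eigenvalues i * x i ^ 2 := by
  set b := hA.eigenvectorBasis
  have h1 : A *ᵥ (∑ i, x i • b i).ofLp = (∑ i, (hA.eigenvalues i * x i) • b i).ofLp := by
    simp only [WithLp.ofLp_sum, WithLp.ofLp_smul, Matrix.mulVec_sum, Matrix.mulVec_smul]
    refine Finset.sum_congr rfl fun i _ => ?_
    rw [hA.mulVec_eigenvectorBasis, smul_smul, mul_comm]
  have h2 : ∀ u v : EuclideanSpace ℝ ι, u.ofLp ⬝ᵥ v.ofLp = inner ℝ u v := fun u v => by
    rw [EuclideanSpace.inner_eq_star_dotProduct, star_trivial, dotProduct_comm]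
  rw [h1, h2, b.orthonormal.inner_sum]
  refine Finset.sum_congr rfl fun i _ => ?_
  simp; ring

/-- A quadratic form in a standard Gaussian vector is a combination of independent `χ²₁` variables
with the eigenvalues as coefficients. -/
lemma map_quadForm_stdGaussian {A : Matrix ι ι ℝ} (hA : A.IsHermitian) :
    (stdGaussian (EuclideanSpace ℝ ι)).map (fun x => x.ofLp ⬝ᵥ A *ᵥ x.ofLp)
      = (Measure.pi fun _ : ι => chiSqOne).map fun y => ∑ i, hA.eigenvalues i * y i := by
  have hq : Measurable fun x : EuclideanSpace ℝ ι => x.ofLp ⬝ᵥ A *ᵥ x.ofLp := by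
    simp only [dotProduct, Matrix.mulVec]; fun_prop
  have hpi : (Measure.pi fun _ : ι => chiSqOne)
      = (Measure.pi fun _ : ι => gaussianReal 0 1).map fun x i => x i ^ 2 := by
    simp only [chiSqOne]
    exact (Measure.pi_map_pi (f := fun _ x => x ^ 2) fun i => by fun_prop).symm
  rw [stdGaussian_eq_map_pi_orthonormalBasis hA.eigenvectorBasis, Measure.map_map hq (by fun_prop),
    hpi, Measure.map_map (by fun_prop) (by fun_prop)]
  congr 1
  ext x
  exact dotProduct_mulVec_eigenvectorBasis hA x

variable {r : ℕ} {C : Matrix (Fin r) ι ℝ} {M : Matrix (Fin r) (Fin r) ℝ} {S : Matrix ι ι ℝ}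

lemma isHermitian_sqrt (S : Matrix ι ι ℝ) : (CFC.sqrt S).IsHermitian :=
  (CFC.sqrt_nonneg S).isSelfAdjoint

lemma isHermitian_weightMatrix (C : Matrix (Fin r) ι ℝ) (hM : M.IsHermitian) (S : Matrix ι ι ℝ) :
    (weightMatrix C M S).IsHermitian := by
  have h1 : (CFC.sqrt S)ᵀ = CFC.sqrt S := by simpa using (isHermitian_sqrt S).eq
  have h2 : Mᵀ = M := by simpa using hM.eq
  unfold weightMatrix Matrix.IsHermitian
  simp [Matrix.conjTranspose_eq_transpose_of_trivial, Matrix.transpose_mul, h1, h2, Matrix.mul_assoc]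

lemma rank_weightMatrix_le (C : Matrix (Fin r) ι ℝ) (M : Matrix (Fin r) (Fin r) ℝ)
    (S : Matrix ι ι ℝ) : (weightMatrix C M S).rank ≤ r := by
  unfold weightMatrix
  have h1 := Matrix.rank_mul_le_left (CFC.sqrt S * Cᵀ * M * C) (CFC.sqrt S)
  have h2 := Matrix.rank_mul_le_right (CFC.sqrt S * Cᵀ * M) C
  have h3 : C.rank ≤ r := by simpa using C.rank_le_card_height
  exact h1.trans (h2.trans h3)

/-- The law of the limiting quadratic form of a Gaussian vector as a weighted sum of independent
`χ²₁` variables. -/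
theorem exists_identDistrib_limitForm {Ω' : Type*} [MeasurableSpace Ω'] {P' : Measure Ω'}
    (hM : M.IsHermitian) {Z : Ω' → EuclideanSpace ℝ ι}
    (hZ : HasLaw Z (multivariateGaussian 0 S) P') :
    ∃ w : Fin r → ℝ, AreNonzeroEigenvaluesPadded w (weightMatrix C M S) ∧
      IdentDistrib (fun ω' => limitForm C M S (Z ω').ofLp)
        (fun y : Fin r → ℝ => (√(stdSq C M S))⁻¹ * ∑ i, w i * y i)
        P' (Measure.pi fun _ => chiSqOne) := by
  classical
  have hW := isHermitian_weightMatrix C hM S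
  obtain ⟨w, hw⟩ := exists_areNonzeroEigenvaluesPadded hW (rank_weightMatrix_le C M S)
  refine ⟨w, hw, ?_⟩
  set k := (√(stdSq C M S))⁻¹
  have hq : ∀ B : Matrix ι ι ℝ, Measurable fun x : EuclideanSpace ℝ ι => x.ofLp ⬝ᵥ B *ᵥ x.ofLp :=
    fun B => by simp only [dotProduct, Matrix.mulVec]; fun_prop
  have hconj : ∀ x : ι → ℝ, (C *ᵥ (CFC.sqrt S *ᵥ x)) ⬝ᵥ (M *ᵥ (C *ᵥ (CFC.sqrt S *ᵥ x)))
      = x ⬝ᵥ weightMatrix C M S *ᵥ x := by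
    intro x
    have h1 : (CFC.sqrt S)ᵀ = CFC.sqrt S := by simpa using (isHermitian_sqrt S).eq
    simp only [weightMatrix, ← Matrix.mulVec_mulVec]
    rw [Matrix.dotProduct_mulVec x, ← Matrix.mulVec_transpose, h1, Matrix.dotProduct_mulVec _ Cᵀ,
      Matrix.vecMul_transpose]
  have hl : Measurable fun z : EuclideanSpace ℝ ι => limitForm C M S z.ofLp := by
    simp only [limitForm, dotProduct, Matrix.mulVec]; fun_prop
  refine ⟨hl.comp_aemeasurable hZ.aemeasurable, Measurable.aemeasurable (by fun_prop), ?_⟩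
  have hs : Measurable fun x : EuclideanSpace ℝ ι =>
      (0 : EuclideanSpace ℝ ι) + Matrix.toEuclideanCLM (𝕜 := ℝ) (CFC.sqrt S) x := by fun_prop
  -- `multivariateGaussian 0 S` is by definition the image of the standard Gaussian under `S^{1/2}`
  have e1 : P'.map (fun ω' => limitForm C M S (Z ω').ofLp)
      = ((stdGaussian (EuclideanSpace ℝ ι)).map
          fun x => x.ofLp ⬝ᵥ weightMatrix C M S *ᵥ x.ofLp).map fun u => k * u := by
    have := AEMeasurable.map_map_of_aemeasurable (μ := P') hl.aemeasurable hZ.aemeasurable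
    rw [← Function.comp_def (fun z : EuclideanSpace ℝ ι => limitForm C M S z.ofLp) Z, ← this,
      hZ.map_eq, multivariateGaussian, Measure.map_map hl hs,
      Measure.map_map (by fun_prop) (hq _)]
    congr 1
    ext x
    simp only [Function.comp_def, limitForm, zero_add, Matrix.ofLp_toEuclideanCLM, hconj, k]
  have e2 : (Measure.pi fun _ : Fin r => chiSqOne).map (fun y => k * ∑ i, w i * y i)
      = ((Measure.pi fun _ : Fin r => chiSqOne).map fun y => ∑ i, w i * y i).map
          fun u => k * u := by
    rw [Measure.map_map (by fun_prop) (by fun_prop)]; rfl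
  rw [e1, e2, map_quadForm_stdGaussian hW]
  congr 1
  refine map_sum_mul_pi_eq chiSqOne ?_
  unfold AreNonzeroEigenvaluesPadded at hw
  rw [hw, hW.roots_charpoly_eq_eigenvalues]
  rfl

end

end QFMCT

/-! ### Limit laws of the standardized quadratic forms -/

theorem mainTheorem1
    {Ω Ω' : Type*} [MeasurableSpace Ω] [MeasurableSpace Ω']
    (P : Measure Ω) [IsProbabilityMeasure P] (P' : Measure Ω') [IsProbabilityMeasure P']
    (a d : ℕ) (ha : 2 ≤ a)
    -- the semiparametric model: independent errors, identically distributed components within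
    -- each group, centred, with group covariance matrix `Sg i`
    (μ : Fin a × Fin d → ℝ) (ε : Fin a → ℕ → Ω → Fin d → ℝ)
    (Sg : Fin a → Matrix (Fin d) (Fin d) ℝ)
    (hindep : iIndepFun (fun (p : Fin a × ℕ) (ω : Ω) => ε p.1 p.2 ω) P)
    (hident : ∀ i j k k', IdentDistrib (fun ω => ε i k ω j) (fun ω => ε i k' ω j) P P)
    (hL2 : ∀ i k j, MemLp (fun ω => ε i k ω j) 2 P)
    (hmean : ∀ i k j, ∫ ω, ε i k ω j ∂P = 0)
    (hcov : ∀ i k j j', cov[fun ω => ε i k ω j, fun ω => ε i k ω j'; P] = Sg i j j')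
    -- sample sizes
    (n : ℕ → Fin a → ℕ) (κ : Fin a → ℝ) (hκ : ∀ i, κ i ∈ Set.Ioc (0 : ℝ) 1)
    (hN : Tendsto (fun m => ∑ i, n m i) atTop atTop)
    (hratio : ∀ i, Tendsto (fun m => (n m i : ℝ) / ((∑ i', n m i' : ℕ) : ℝ)) atTop (𝓝 (κ i)))
    -- the partitioned hypothesis
    (L : ℕ) (r : Fin L → ℕ)
    (C : Matrix ((ℓ : Fin L) × Fin (r ℓ)) (Fin a × Fin d) ℝ)
    (β : ((ℓ : Fin L) × Fin (r ℓ)) → ℝ)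
    -- the matrix-valued function and the covariance estimator
    (M : ∀ s : ℕ, Matrix (Fin s) (Fin a × Fin d) ℝ →
      Matrix (Fin a × Fin d) (Fin a × Fin d) ℝ → Matrix (Fin s) (Fin s) ℝ)
    (hM : ∀ ℓ S, S.PosSemidef → (M (r ℓ) (QFMCT.blockMat C ℓ) S).PosSemidef)
    (Shat : ℕ → Ω → Matrix (Fin a × Fin d) (Fin a × Fin d) ℝ)
    (hShat_meas : ∀ m p q, AEMeasurable (fun ω => Shat m ω p q) P)
    (hMShat_meas : ∀ m ℓ s t,
      AEMeasurable (fun ω => M (r ℓ) (QFMCT.blockMat C ℓ) (Shat m ω) s t) P)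
    (hShat : ∀ p q, TendstoInMeasure P (fun m ω => Shat m ω p q) atTop
      (fun _ => QFMCT.pooledCov κ Sg p q))
    (hMShat : ∀ ℓ s t, TendstoInMeasure P
      (fun m ω => M (r ℓ) (QFMCT.blockMat C ℓ) (Shat m ω) s t) atTop
      (fun _ => M (r ℓ) (QFMCT.blockMat C ℓ) (QFMCT.pooledCov κ Sg) s t))
    -- the Gaussian vector
    (Z : Ω' → EuclideanSpace ℝ (Fin a × Fin d))
    (hZ : HasLaw Z (multivariateGaussian 0 (QFMCT.pooledCov κ Sg)) P') :
    let Sig := QFMCT.pooledCov κ Sg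
    let MC : ∀ ℓ : Fin L, Matrix (Fin (r ℓ)) (Fin (r ℓ)) ℝ :=
      fun ℓ => M (r ℓ) (QFMCT.blockMat C ℓ) Sig
    let v : Fin L → ℝ := fun ℓ => QFMCT.stdSq (QFMCT.blockMat C ℓ) (MC ℓ) Sig
    let QN : ℕ → Ω → Fin L → ℝ := fun m ω ℓ =>
      QFMCT.quadStat ((∑ i, n m i : ℕ) : ℝ) (QFMCT.blockMat C ℓ) (QFMCT.blockVec β ℓ)
        (M (r ℓ) (QFMCT.blockMat C ℓ) (Shat m ω)) (Shat m ω)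
        (QFMCT.groupMeans (QFMCT.obs μ ε) (n m) ω)
    let Q : Ω' → Fin L → ℝ := fun ω' ℓ =>
      QFMCT.limitForm (QFMCT.blockMat C ℓ) (MC ℓ) Sig (fun p => Z ω' p)
    -- each true local hypothesis
    (∀ ℓ, 0 < v ℓ → QFMCT.blockMat C ℓ *ᵥ μ = QFMCT.blockVec β ℓ →
      TendstoInDistribution (fun m ω => QN m ω ℓ) atTop (fun ω' => Q ω' ℓ) (fun _ => P) P' ∧
      ∃ w : Fin (r ℓ) → ℝ,
        QFMCT.AreNonzeroEigenvaluesPadded w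
          (QFMCT.weightMatrix (QFMCT.blockMat C ℓ) (MC ℓ) Sig) ∧
        IdentDistrib (fun ω' => Q ω' ℓ)
          (fun y : Fin (r ℓ) → ℝ => (√(v ℓ))⁻¹ * ∑ i, w i * y i)
          P' (Measure.pi fun _ => QFMCT.chiSqOne)) ∧
    -- the global hypothesis
    ((∀ ℓ, 0 < v ℓ) → C *ᵥ μ = β →
      TendstoInDistribution QN atTop Q (fun _ => P) P') ∧
    -- every set of true local hypotheses
    (∀ T : Finset (Fin L), (∀ ℓ ∈ T, 0 < v ℓ) →
      (∀ ℓ ∈ T, QFMCT.blockMat C ℓ *ᵥ μ = QFMCT.blockVec β ℓ) →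
      TendstoInDistribution (fun m ω (ℓ : T) => QN m ω ℓ) atTop
        (fun ω' (ℓ : T) => Q ω' ℓ) (fun _ => P) P') := by

  intro Sig MC v QN Q
  have hκ0 : ∀ i, 0 < κ i := fun i => (hκ i).1
  have hS : Sig.PosSemidef := QFMCT.posSemidef_pooledCov (fun i => (hκ0 i).le)
    fun i => QFMCT.posSemidef_of_covariance (hL2 i 0) (hmean i 0) (hcov i 0)
  have hY := QFMCT.tendstoInDistribution_scaledMeans (μ := μ) hindep hident hL2 hmean hcov hκ0 hN
    hratio hZ
  -- any finite family of true local hypotheses can be treated simultaneously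
  have main : ∀ {J : Type} [Fintype J] (f : J → Fin L), (∀ j, 0 < v (f j)) →
      (∀ j, QFMCT.blockMat C (f j) *ᵥ μ = QFMCT.blockVec β (f j)) →
      TendstoInDistribution (fun m ω j => QN m ω (f j)) atTop (fun ω' j => Q ω' (f j))
        (fun _ => P) P' := by
    intro J _ f hv hH
    have h := QFMCT.tendstoInDistribution_quadForms hY
      (D := fun m ω j p q => QFMCT.standardizedForm (QFMCT.blockMat C (f j))
        (M (r (f j)) (QFMCT.blockMat C (f j)) (Shat m ω)) (Shat m ω) p q)
      (D₀ := fun j p q => QFMCT.standardizedForm (QFMCT.blockMat C (f j)) (MC (f j)) Sig p q)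
      (fun m j => QFMCT.aemeasurable_standardizedForm (hMShat_meas m (f j)) (hShat_meas m) _)
      (fun j => QFMCT.tendstoInMeasure_standardizedForm (hMShat (f j)) hShat (hv j))
    refine h.congr (fun m => ae_of_all _ fun ω => funext fun j => ?_)
      (ae_of_all _ fun ω' => funext fun j => ?_)
    · exact (QFMCT.quadStat_eq (Nat.cast_nonneg _) (hH j) _ _ _).symm
    · exact (QFMCT.limitForm_eq (hv j) _).symm
  refine ⟨fun ℓ hv hH => ⟨?_, ?_⟩, fun hv hH => ?_, fun T hv hH => ?_⟩
  · exact (main (fun _ : Unit => ℓ) (fun _ => hv) fun _ => hH).continuous_comp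
      (g := fun x : Unit → ℝ => x ()) (by fun_prop)
  · exact QFMCT.exists_identDistrib_limitForm (hM ℓ Sig hS).isHermitian hZ
  · refine main id hv fun ℓ => funext fun t => ?_
    exact congrFun hH ⟨ℓ, t⟩
  · exact main (fun ℓ : T => (ℓ : Fin L)) (fun ℓ => hv ℓ ℓ.2) fun ℓ => hH ℓ ℓ.2
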